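/- Let $n$ be a dimension and let $1<p,q<\infty$. For a measurable function $f:\mathbf R^n\to\mathbf C$ let $$M(f)(x)=\sup_{B\ni x}\frac1{|B|}\int_B|f(z)|\,dz$$ be the (uncentred) Hardy--Littlewood maximal function, where the supremum is over all open balls $B\subset\mathbf R^n$ containing $x$, and for a function $F:\mathbf R^n\to[0,\infty]$ let $$\|F\|_{L^{p,\infty}}=\sup_{t>0}\,t\,\bigl|\{x\in\mathbf R^n: F(x)>t\}\bigr|^{1/p}.$$ Then there is a finite constant $C=C_{n,p,q}$, depending only on $n,p,q$, such that for every sequence $\{f_j\}_{j\in\mathbf Z}$ of measurable functions $f_j:\mathbf R^n\to\mathbf C$ that lies in $L^{p,\infty}(\ell^q)$, i.e. for which the function $x\mapsto\bigl(\sum_{j\in\mathbf Z}|f_j(x)|^q\bigr)^{1/q}$ has finite $L^{p,\infty}$ quasinorm, we have $$\Bigl\|\Bigl(\sum_{j\in\mathbf Z}M(f_j)^q\Bigr)^{1/q}\Bigr\|_{L^{p,\infty}}\le C\,\Bigl\|\Bigl(\sum_{j\in\mathbf Z}|f_j|^q\Bigr)^{1/q}\Bigr\|_{L^{p,\infty}}.$$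 -/

import Mathlib

open MeasureTheory
open scoped ENNReal NNReal

noncomputable section

/-- The (uncentred) Hardy-Littlewood maximal function on `ℝⁿ`: the supremum of the averages of
`|f|` over all open Euclidean balls that contain the point `x`. It takes values in `[0, ∞]`. -/
def hlMaximal {n : ℕ} (f : EuclideanSpace ℝ (Fin n) → ℂ) (x : EuclideanSpace ℝ (Fin n)) : ℝ≥0∞ :=
  ⨆ (y : EuclideanSpace ℝ (Fin n)) (r : ℝ) (_ : 0 < r) (_ : x ∈ Metric.ball y r),
    (∫⁻ z in Metric.ball y r, ‖f z‖ₑ) / volume (Metric.ball y r)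

/-- The `ℓ^q` norm of a sequence in `[0, ∞]`, indexed by the integers. -/
def lqNorm (q : ℝ) (a : ℤ → ℝ≥0∞) : ℝ≥0∞ :=
  (∑' j, a j ^ q) ^ (1 / q)

/-- The weak `L^p` quasinorm of a `[0, ∞]`-valued function `F` on `ℝⁿ`:
`sup_{t > 0} t * |{F > t}|^{1/p}`. -/
def weakLpNorm {n : ℕ} (p : ℝ) (F : EuclideanSpace ℝ (Fin n) → ℝ≥0∞) : ℝ≥0∞ :=
  ⨆ (t : ℝ≥0) (_ : 0 < t), (t : ℝ≥0∞) * volume {x | (t : ℝ≥0∞) < F x} ^ (1 / p)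

/-- `{f_j}` lies in `L^{p,∞}(ℝⁿ, ℓ^q)`: every `f_j` is Lebesgue measurable and the function
`x ↦ ‖{f_j(x)}‖_{ℓ^q}` has finite weak `L^p` quasinorm. -/
def MemWeakLpLq {n : ℕ} (p q : ℝ) (f : ℤ → EuclideanSpace ℝ (Fin n) → ℂ) : Prop :=
  (∀ j, AEMeasurable (f j)) ∧ weakLpNorm p (fun x => lqNorm q (fun j => ‖f j x‖ₑ)) < ∞

end

/-!
The proof has three ingredients.

* A weighted inequality. The Vitali covering lemma gives
  `t * ν {M μ > t} ≤ 5 ^ n * ∫ M ν dμ` for any two measures (`mul_measure_lt_maxMeas_le`). Truncating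
  at height `t` and summing over dyadic heights turns it into
  `∫ (M u) ^ q dν ≤ C * ∫ u ^ q * M ν` (`exists_lintegral_maxMeas_rpow_le`). With `ν` the restriction
  of Lebesgue measure to a subset `E` of a level set, this inequality can be summed over the terms of
  a sequence; Hölder's inequality then gives the vector-valued weak type `(r, r)` bound for every
  `r > q` (`exists_measure_lt_lqNorm_maxMeas_le`).

* The scalar bound of `M` on weak `L^p` for `p > 1` (`exists_measure_lt_maxMeas_le`).

* A Calderón–Zygmund decomposition without cubes. Let `G` be the `ℓ^q` norm of the sequence and `Ω`
  an open set containing `{G > 2t}` and `{M G > 2t}`, of measure comparable to that allowed by the weak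
  bounds of `G` and `M G`. On `Ω`, each term is replaced by its average over the ball around `y` of
  radius half the distance from `y` to the complement. The new sequence has `ℓ^q` norm bounded by a
  multiple of `t`, by Minkowski's inequality (`lqNorm_whitneyAvg_le`), and at the points outside `Ω`
  its maximal functions dominate the original ones up to a constant (`maxMeas_le_whitneyAvg`).

The `ℓ^q` norm of the new sequence is bounded and in weak `L^p`, hence in `L^r` for `r = p + q`, and the
weak type `(r, r)` bound controls its maximal functions at height `t`. As `r > max p q` for all `p`
and `q`, no interpolation or distinction between `p < q` and `p > q` is needed.
-/

/-! ### Dyadic sums in `[0, ∞]` -/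

section Dyadic

lemma two_zpow_ne_zero (k : ℤ) : (2 : ℝ≥0∞) ^ k ≠ 0 :=
  (ENNReal.zpow_pos (by simp) (by simp) k).ne'

lemma two_zpow_ne_top (k : ℤ) : (2 : ℝ≥0∞) ^ k ≠ ∞ :=
  ENNReal.zpow_ne_top (by simp) (by simp) k

lemma mul_rpow_sub_one {q : ℝ} {x : ℝ≥0∞} (hq : 1 ≤ q) : x * x ^ (q - 1) = x ^ q := by
  conv_lhs => rw [← ENNReal.rpow_one x, ← ENNReal.rpow_mul, one_mul]
  rw [← ENNReal.rpow_add_of_nonneg _ _ zero_le_one (by linarith)]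
  congr 1
  ring

/-- A power is bounded by its dyadic layers; this holds for `a = ∞` too, where the sum diverges. -/
lemma rpow_le_tsum_dyadic {θ : ℝ} (hθ : 0 < θ) (a : ℝ≥0∞) :
    a ^ θ ≤ ∑' k : ℤ, if (2 : ℝ≥0∞) ^ k < a then ((2 : ℝ≥0∞) ^ (k + 1)) ^ θ else 0 := by
  have hterm : ∀ k : ℤ, (2 : ℝ≥0∞) ^ k < a → ((2 : ℝ≥0∞) ^ (k + 1)) ^ θ ≤
      ∑' k : ℤ, if (2 : ℝ≥0∞) ^ k < a then ((2 : ℝ≥0∞) ^ (k + 1)) ^ θ else 0 := by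
    intro k hk
    have := ENNReal.le_tsum (f := fun k : ℤ =>
      if (2 : ℝ≥0∞) ^ k < a then ((2 : ℝ≥0∞) ^ (k + 1)) ^ θ else 0) k
    simpa [hk] using this
  rcases eq_or_ne a 0 with rfl | h0
  · simp [ENNReal.zero_rpow_of_pos hθ]
  rcases eq_or_ne a ∞ with rfl | htop
  · rw [ENNReal.top_rpow_of_pos hθ, top_le_iff]
    refine ENNReal.eq_top_of_forall_nnreal_le fun r => ?_
    obtain ⟨m, hm⟩ := ENNReal.exists_nat_gt (r := (r : ℝ≥0∞) ^ (1 / θ))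
      (by simp [ENNReal.rpow_eq_top_iff, not_lt.2 hθ.le])
    have h2 : (m : ℝ≥0∞) ≤ (2 : ℝ≥0∞) ^ ((m : ℤ) + 1) := by
      have : m ≤ 2 ^ (m + 1) := (Nat.lt_two_pow_self.trans (Nat.pow_lt_pow_right (by simp)
        (Nat.lt_succ_self m))).le
      exact_mod_cast this
    refine le_trans ?_ (hterm m ?_)
    · have := ENNReal.rpow_le_rpow (hm.le.trans h2) hθ.le
      rwa [← ENNReal.rpow_mul, one_div_mul_cancel hθ.ne', ENNReal.rpow_one] at this
    · exact lt_top_iff_ne_top.2 (ENNReal.zpow_ne_top (by simp) (by simp) _)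
  obtain ⟨k, hk⟩ := ENNReal.exists_mem_Ioc_zpow h0 htop (y := 2) (by simp) (by simp)
  exact (ENNReal.rpow_le_rpow hk.2 hθ.le).trans (hterm k hk.1)

/-- The converse of `rpow_le_tsum_dyadic`: for `θ > 0` the layers form a geometric series dominated
by the top one. Replacing `k` by `-k`, the same bound controls the layers above a given height for
negative exponents. -/
lemma exists_tsum_dyadic_le {θ : ℝ} (hθ : 0 < θ) :
    ∃ C : ℝ≥0∞, C ≠ 0 ∧ C ≠ ∞ ∧ ∀ a : ℝ≥0∞,
      (∑' k : ℤ, if (2 : ℝ≥0∞) ^ k < a then ((2 : ℝ≥0∞) ^ k) ^ θ else 0) ≤ C * a ^ θ := by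
  set x : ℝ≥0∞ := 2 ^ (-θ) with hx
  have hx1 : x < 1 := ENNReal.rpow_lt_one_of_one_lt_of_neg (by simp) (by linarith)
  have hC0 : (1 - x)⁻¹ ≠ 0 := ENNReal.inv_ne_zero.2 (by
    exact ne_top_of_le_ne_top (by simp) tsub_le_self)
  refine ⟨(1 - x)⁻¹, hC0, ENNReal.inv_ne_top.2 (tsub_pos_of_lt hx1).ne', fun a => ?_⟩
  rcases eq_or_ne a 0 with rfl | h0
  · simp
  rcases eq_or_ne a ∞ with rfl | htop
  · rw [ENNReal.top_rpow_of_pos hθ, ENNReal.mul_top hC0]; exact le_top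
  obtain ⟨m, hm⟩ := ENNReal.exists_mem_Ioc_zpow h0 htop (y := 2) (by simp) (by simp)
  -- only `k ≤ m` contribute: sum over `i = m - k`
  rw [← (Equiv.subLeft m).tsum_eq]
  have hinj : Function.Injective (fun i : ℕ => (i : ℤ)) := Nat.cast_injective
  rw [← hinj.tsum_eq]
  · calc _ ≤ ∑' i : ℕ, x ^ i * ((2 : ℝ≥0∞) ^ m) ^ θ := by
          refine ENNReal.tsum_le_tsum fun i => ?_
          simp only [Equiv.subLeft_apply]
          split_ifs
          · rw [hx, ← ENNReal.rpow_natCast, ← ENNReal.rpow_intCast, ← ENNReal.rpow_intCast,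
              ← ENNReal.rpow_mul, ← ENNReal.rpow_mul, ← ENNReal.rpow_mul,
              ← ENNReal.rpow_add _ _ (by simp) (by simp)]
            apply le_of_eq
            congr 1
            push_cast
            ring
          · simp
      _ = (1 - x)⁻¹ * ((2 : ℝ≥0∞) ^ m) ^ θ := by
          rw [ENNReal.tsum_mul_right, ENNReal.tsum_geometric]
      _ ≤ _ := by gcongr; exact hm.1.le
  · intro k hk
    simp only [Equiv.subLeft_apply, Function.mem_support, ne_eq, ite_eq_right_iff,
      Classical.not_imp] at hk
    have h1 := hk.1.trans_le hm.2
    have h2 : m - k < m + 1 := by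
      by_contra! hcon
      exact absurd h1 (not_lt.2 (ENNReal.zpow_le_of_le (by simp) hcon))
    exact ⟨k.toNat, by simp; omega⟩

/-- A dyadic layer-cake inequality for functions with values in `[0, ∞]`. -/
lemma lintegral_rpow_le_tsum {α : Type*} [MeasurableSpace α] (ν : Measure α) {F : α → ℝ≥0∞}
    (hF : Measurable F) {θ : ℝ} (hθ : 0 < θ) :
    ∫⁻ x, F x ^ θ ∂ν ≤ ∑' k : ℤ, ((2 : ℝ≥0∞) ^ (k + 1)) ^ θ * ν {x | (2 : ℝ≥0∞) ^ k < F x} := by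
  have hmeas : ∀ k : ℤ, MeasurableSet {x | (2 : ℝ≥0∞) ^ k < F x} := fun k =>
    measurableSet_lt measurable_const hF
  calc ∫⁻ x, F x ^ θ ∂ν
      ≤ ∫⁻ x, ∑' k : ℤ, {x | (2 : ℝ≥0∞) ^ k < F x}.indicator
          (fun _ => ((2 : ℝ≥0∞) ^ (k + 1)) ^ θ) x ∂ν := by
        refine lintegral_mono fun x => ?_
        simpa [Set.indicator_apply] using rpow_le_tsum_dyadic hθ (F x)
    _ = _ := by
        rw [lintegral_tsum fun k => (measurable_const.indicator (hmeas k)).aemeasurable]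
        refine tsum_congr fun k => ?_
        rw [lintegral_indicator_const (hmeas k)]

/-- A bounded function in weak `L^p` lies in `L^r` for every `r > p`, with the norm controlled by the
weak constant and the bound. -/
lemma exists_lintegral_rpow_le_of_le {α : Type*} [MeasurableSpace α] (μ : Measure α)
    {p r : ℝ} (hp : 0 < p) (hr : p < r) :
    ∃ C : ℝ≥0∞, C ≠ ∞ ∧ ∀ H : α → ℝ≥0∞, Measurable H → ∀ A T : ℝ≥0∞, (∀ x, H x ≤ T) →
      (∀ s : ℝ≥0∞, s ≠ 0 → s ≠ ∞ → μ {x | s < H x} ≤ A * s ^ (-p)) →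
      ∫⁻ x, H x ^ r ∂μ ≤ C * A * T ^ (r - p) := by
  obtain ⟨C, -, hC, h⟩ := exists_tsum_dyadic_le (θ := r - p) (by linarith)
  have h2 : (2 : ℝ≥0∞) ^ r ≠ ∞ := ENNReal.rpow_ne_top_of_nonneg (by linarith) (by simp)
  refine ⟨2 ^ r * C, ENNReal.mul_ne_top h2 hC, fun H hH A T hT hA => ?_⟩
  calc ∫⁻ x, H x ^ r ∂μ
      ≤ ∑' k : ℤ, ((2 : ℝ≥0∞) ^ (k + 1)) ^ r * μ {x | (2 : ℝ≥0∞) ^ k < H x} :=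
        lintegral_rpow_le_tsum _ hH (by linarith)
    _ ≤ ∑' k : ℤ, 2 ^ r * A * (if (2 : ℝ≥0∞) ^ k < T then ((2 : ℝ≥0∞) ^ k) ^ (r - p) else 0) := by
        refine ENNReal.tsum_le_tsum fun k => ?_
        have ha0 := two_zpow_ne_zero k
        have hat := two_zpow_ne_top k
        rw [ENNReal.zpow_add (by simp) (by simp), zpow_one]
        set a : ℝ≥0∞ := 2 ^ k
        split_ifs with hk
        · calc (a * 2) ^ r * μ {x | a < H x} ≤ (a * 2) ^ r * (A * a ^ (-p)) := by
                gcongr; exact hA a ha0 hat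
            _ = 2 ^ r * A * (a ^ r * a ^ (-p)) := by
                rw [ENNReal.mul_rpow_of_nonneg _ _ (by linarith)]; ring
            _ = _ := by rw [← ENNReal.rpow_add _ _ ha0 hat, sub_eq_add_neg]
        · have : {x | a < H x} = ∅ := by
            ext x
            simpa using (hT x).trans (not_lt.1 hk)
          simp [this]
    _ = 2 ^ r * A * ∑' k : ℤ, if (2 : ℝ≥0∞) ^ k < T then ((2 : ℝ≥0∞) ^ k) ^ (r - p) else 0 := by
        rw [ENNReal.tsum_mul_left]
    _ ≤ 2 ^ r * A * (C * T ^ (r - p)) := by gcongr; exact h T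
    _ = _ := by ring

end Dyadic

/-! ### The `ℓ^q` norm -/

section SequenceNorm

lemma lqNorm_rpow_self {q : ℝ} (hq : 0 < q) (a : ℤ → ℝ≥0∞) :
    lqNorm q a ^ q = ∑' j, a j ^ q := by
  rw [lqNorm, ← ENNReal.rpow_mul, one_div_mul_cancel hq.ne', ENNReal.rpow_one]

lemma measurable_lqNorm {α : Type*} [MeasurableSpace α] {q : ℝ} {v : ℤ → α → ℝ≥0∞}
    (hv : ∀ j, Measurable (v j)) : Measurable fun x => lqNorm q (fun j => v j x) :=
  (Measurable.tsum fun j => (hv j).pow_const q).pow_const _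

lemma lqNorm_mono {q : ℝ} (hq : 0 < q) {a b : ℤ → ℝ≥0∞} (h : ∀ j, a j ≤ b j) :
    lqNorm q a ≤ lqNorm q b :=
  ENNReal.rpow_le_rpow (ENNReal.tsum_le_tsum fun j => ENNReal.rpow_le_rpow (h j) hq.le)
    (by positivity)

lemma lqNorm_const_mul {q : ℝ} (hq : 0 < q) (c : ℝ≥0∞) (a : ℤ → ℝ≥0∞) :
    lqNorm q (fun j => c * a j) = c * lqNorm q a := by
  simp_rw [lqNorm, ENNReal.mul_rpow_of_nonneg _ _ hq.le]
  rw [ENNReal.tsum_mul_left, ENNReal.mul_rpow_of_nonneg _ _ (by positivity), ← ENNReal.rpow_mul,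
    mul_one_div_cancel hq.ne', ENNReal.rpow_one]

lemma le_lqNorm {q : ℝ} (hq : 0 < q) (a : ℤ → ℝ≥0∞) (j : ℤ) : a j ≤ lqNorm q a := by
  rw [← ENNReal.rpow_le_rpow_iff hq, lqNorm_rpow_self hq]
  exact ENNReal.le_tsum j

/-- Minkowski's integral inequality for the `ℓ^q` norm. With `a j = ∫ u j`, Hölder's inequality under
the integral sign in `∑ a j ^ q = ∫ ∑ a j ^ (q - 1) * u j` bounds the partial sums, which are finite,
so that a power of them can be cancelled. -/
lemma lqNorm_lintegral_le {α : Type*} [MeasurableSpace α] (ν : Measure α) {q : ℝ} (hq : 1 < q)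
    {u : ℤ → α → ℝ≥0∞} (hu : ∀ j, Measurable (u j)) :
    lqNorm q (fun j => ∫⁻ x, u j x ∂ν) ≤ ∫⁻ x, lqNorm q (fun j => u j x) ∂ν := by
  have hq0 : 0 < q := by linarith
  have hconj : (q / (q - 1)).HolderConjugate q := by
    rw [Real.holderConjugate_iff]
    have : 0 < q - 1 := by linarith
    refine ⟨by rw [one_lt_div this]; linarith, ?_⟩
    field_simp
    ring
  set J := ∫⁻ x, lqNorm q (fun j => u j x) ∂ν with hJ
  rcases eq_or_ne J ∞ with hJt | hJt
  · rw [hJt]; exact le_top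
  set a : ℤ → ℝ≥0∞ := fun j => ∫⁻ x, u j x ∂ν with ha
  have hat : ∀ j, a j ≠ ∞ := fun j =>
    ne_top_of_le_ne_top hJt (lintegral_mono fun x => le_lqNorm hq0 (fun j => u j x) j)
  rw [← ENNReal.rpow_le_rpow_iff hq0, lqNorm_rpow_self hq0, ENNReal.tsum_eq_iSup_sum]
  refine iSup_le fun s => ?_
  set S := ∑ j ∈ s, a j ^ q with hS
  rcases eq_or_ne S 0 with hS0 | hS0
  · rw [hS0]; exact bot_le
  have hSt : S ≠ ∞ := ENNReal.sum_ne_top.2 fun j _ => ENNReal.rpow_ne_top_of_nonneg hq0.le (hat j)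
  set σ := 1 / (q / (q - 1)) with hσ
  have hσ0 : 0 ≤ σ := by
    have : 0 < q - 1 := by linarith
    positivity
  have hσ1 : σ + 1 / q = 1 := by
    have : q - 1 ≠ 0 := by linarith
    rw [hσ]; field_simp; ring
  have hle : S ≤ S ^ σ * J := by
    calc S = ∑ j ∈ s, ∫⁻ x, a j ^ (q - 1) * u j x ∂ν := by
          refine Finset.sum_congr rfl fun j _ => ?_
          rw [lintegral_const_mul _ (hu j), ← mul_rpow_sub_one hq.le, mul_comm]
      _ = ∫⁻ x, ∑ j ∈ s, a j ^ (q - 1) * u j x ∂ν :=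
          (lintegral_finsetSum _ fun j _ => (hu j).const_mul _).symm
      _ ≤ ∫⁻ x, S ^ σ * lqNorm q (fun j => u j x) ∂ν := by
          refine lintegral_mono fun x => ?_
          refine (ENNReal.inner_le_Lp_mul_Lq s _ _ hconj).trans ?_
          gcongr ?_ * ?_
          · apply le_of_eq
            congr 1
            refine Finset.sum_congr rfl fun j _ => ?_
            rw [← ENNReal.rpow_mul]
            congr 1
            have : q - 1 ≠ 0 := by linarith
            field_simp
          · exact ENNReal.rpow_le_rpow (ENNReal.sum_le_tsum s) (by positivity)
      _ = _ := by rw [lintegral_const_mul _ (measurable_lqNorm hu)]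
  have h2 : S ^ (1 / q) ≤ J := by
    rw [← ENNReal.mul_le_mul_iff_right (a := S ^ σ)
      (ENNReal.rpow_pos (pos_iff_ne_zero.2 hS0) hSt).ne' (ENNReal.rpow_ne_top_of_nonneg hσ0 hSt),
      ← ENNReal.rpow_add _ _ hS0 hSt, hσ1, ENNReal.rpow_one]
    exact hle
  have h3 := ENNReal.rpow_le_rpow h2 hq0.le
  rwa [← ENNReal.rpow_mul, one_div_mul_cancel hq0.ne', ENNReal.rpow_one] at h3

end SequenceNorm

/-! ### The maximal function of a measure -/

section Maximal

variable {n : ℕ}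

local notation "𝔼" => EuclideanSpace ℝ (Fin n)

/-- The uncentred maximal function of a Borel measure `μ` on `ℝⁿ`: the supremum of
`μ(B) / |B|` over the open balls `B` containing the point. The maximal function of a function
`u` is that of the measure with density `u`; allowing measures lets one lemma serve the
function, the weight and the indicator of a set alike. -/
noncomputable def maxMeas (μ : Measure 𝔼) (x : 𝔼) : ℝ≥0∞ :=
  ⨆ (y : 𝔼) (r : ℝ) (_ : 0 < r) (_ : x ∈ Metric.ball y r),
    μ (Metric.ball y r) / volume (Metric.ball y r)

lemma volume_ball_mul (y z : 𝔼) {a r : ℝ} (ha : 0 < a) (hr : 0 < r) :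
    volume (Metric.ball y (a * r)) = ENNReal.ofReal a ^ n * volume (Metric.ball z r) := by
  rw [Measure.addHaar_ball_of_pos _ _ (by positivity), Measure.addHaar_ball_of_pos _ z hr,
    mul_pow, ENNReal.ofReal_mul (by positivity), ← mul_assoc, finrank_euclideanSpace_fin,
    ENNReal.ofReal_pow ha.le]

lemma le_maxMeas (μ : Measure 𝔼) {x y : 𝔼} {r : ℝ} (hx : x ∈ Metric.ball y r) :
    μ (Metric.ball y r) / volume (Metric.ball y r) ≤ maxMeas μ x :=
  le_iSup_of_le y (le_iSup_of_le r (le_iSup_of_le (Metric.pos_of_mem_ball hx)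
    (le_iSup_of_le hx le_rfl)))

lemma lt_maxMeas_iff {μ : Measure 𝔼} {x : 𝔼} {t : ℝ≥0∞} :
    t < maxMeas μ x ↔ ∃ (y : 𝔼) (r : ℝ), 0 < r ∧ x ∈ Metric.ball y r ∧
      t < μ (Metric.ball y r) / volume (Metric.ball y r) := by
  simp only [maxMeas, lt_iSup_iff, exists_prop]

lemma isOpen_lt_maxMeas (μ : Measure 𝔼) (t : ℝ≥0∞) : IsOpen {x | t < maxMeas μ x} := by
  rw [isOpen_iff_mem_nhds]
  intro x hx
  obtain ⟨y, r, hr, hxy, ht⟩ := lt_maxMeas_iff.1 hx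
  filter_upwards [Metric.isOpen_ball.mem_nhds hxy] with z hz
  exact ht.trans_le (le_maxMeas μ hz)

lemma measurable_maxMeas (μ : Measure 𝔼) : Measurable (maxMeas μ) :=
  measurable_of_Ioi fun t => (isOpen_lt_maxMeas μ t).measurableSet

lemma volume_ball_ne_zero (y : 𝔼) {r : ℝ} (hr : 0 < r) : volume (Metric.ball y r) ≠ 0 :=
  (Metric.measure_ball_pos _ _ hr).ne'

lemma volume_ball_ne_top (y : 𝔼) (r : ℝ) : volume (Metric.ball y r) ≠ ∞ :=
  measure_ball_lt_top.ne

lemma maxMeas_volume_le (x : 𝔼) : maxMeas volume x ≤ 1 := by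
  refine iSup_le fun y => iSup_le fun r => iSup_le fun hr => iSup_le fun _ => ?_
  exact ENNReal.div_self_le_one

/-- `mul_measure_lt_maxMeas_le` with balls of bounded radius, which is what the Vitali covering lemma
needs. For a selected ball `B`, the average of `ν` over `5B` is at most `maxMeas ν` at each point of
`B`, while `t |B| ≤ μ B`. -/
lemma measure_biUnion_ball_le (μ ν : Measure 𝔼) {t : ℝ≥0∞} (R : ℝ) :
    t * ν (⋃ a ∈ {a : 𝔼 × ℝ | 0 < a.2 ∧ a.2 ≤ R ∧
        t < μ (Metric.ball a.1 a.2) / volume (Metric.ball a.1 a.2)}, Metric.ball a.1 a.2) ≤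
      5 ^ n * ∫⁻ x, maxMeas ν x ∂μ := by
  set S := {a : 𝔼 × ℝ | 0 < a.2 ∧ a.2 ≤ R ∧
        t < μ (Metric.ball a.1 a.2) / volume (Metric.ball a.1 a.2)} with hS
  obtain ⟨u, huS, hdisj, hcov⟩ := Vitali.exists_disjoint_subfamily_covering_enlargement_ball
    S (fun a => a.1) (fun a => a.2) R (fun a ha => ha.2.1) 5 (by norm_num)
  have hcount : u.Countable := hdisj.countable_of_isOpen (fun a _ => Metric.isOpen_ball)
    (fun a ha => Metric.nonempty_ball.2 (huS ha).1)
  have hsub : (⋃ a ∈ S, Metric.ball a.1 a.2) ⊆ ⋃ b ∈ u, Metric.ball b.1 (5 * b.2) := by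
    refine Set.iUnion₂_subset fun a ha => ?_
    obtain ⟨b, hb, hab⟩ := hcov a ha
    exact hab.trans (Set.subset_biUnion_of_mem (u := fun b : 𝔼 × ℝ => Metric.ball b.1 (5 * b.2)) hb)
  have hball : ∀ b ∈ u, t * ν (Metric.ball b.1 (5 * b.2)) ≤
      5 ^ n * ∫⁻ x in Metric.ball b.1 b.2, maxMeas ν x ∂μ := by
    intro b hb
    obtain ⟨hr, -, hb⟩ := huS hb
    set V := volume (Metric.ball b.1 b.2) with hV
    have hV0 : V ≠ 0 := volume_ball_ne_zero _ hr
    have hVt : V ≠ ∞ := volume_ball_ne_top _ _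
    have hvol : volume (Metric.ball b.1 (5 * b.2)) = 5 ^ n * V := by
      rw [volume_ball_mul b.1 b.1 (by norm_num) hr]; simp [hV]
    set A := ν (Metric.ball b.1 (5 * b.2)) / (5 ^ n * V) with hA
    have hAν : ν (Metric.ball b.1 (5 * b.2)) = 5 ^ n * (V * A) := by
      rw [← mul_assoc, hA, ENNReal.mul_div_cancel (by simp [hV0])
        (ENNReal.mul_ne_top (by simp) hVt)]
    have hμ : t * V ≤ μ (Metric.ball b.1 b.2) :=
      (ENNReal.le_div_iff_mul_le (Or.inl hV0) (Or.inl hVt)).1 hb.le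
    calc t * ν (Metric.ball b.1 (5 * b.2)) = 5 ^ n * (A * (t * V)) := by rw [hAν]; ring
      _ ≤ 5 ^ n * (A * μ (Metric.ball b.1 b.2)) := by gcongr
      _ = 5 ^ n * ∫⁻ x in Metric.ball b.1 b.2, A ∂μ := by rw [setLIntegral_const]
      _ ≤ _ := by
        gcongr 5 ^ n * ?_
        refine setLIntegral_mono (measurable_maxMeas ν) fun x hx => ?_
        rw [hA, ← hvol]
        exact le_maxMeas ν (Metric.ball_subset_ball (by linarith) hx)
  have := hcount.to_subtype
  calc t * ν (⋃ a ∈ S, Metric.ball a.1 a.2)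
      ≤ t * ∑' b : u, ν (Metric.ball b.1.1 (5 * b.1.2)) := by
        gcongr
        exact (measure_mono hsub).trans (measure_biUnion_le ν hcount _)
    _ = ∑' b : u, t * ν (Metric.ball b.1.1 (5 * b.1.2)) := ENNReal.tsum_mul_left.symm
    _ ≤ ∑' b : u, 5 ^ n * ∫⁻ x in Metric.ball b.1.1 b.1.2, maxMeas ν x ∂μ :=
        ENNReal.tsum_le_tsum fun b => hball b b.2
    _ = 5 ^ n * ∫⁻ x in ⋃ b ∈ u, Metric.ball b.1 b.2, maxMeas ν x ∂μ := by
        rw [ENNReal.tsum_mul_left,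
          lintegral_biUnion hcount (fun _ _ => Metric.isOpen_ball.measurableSet) hdisj]
    _ ≤ _ := mul_le_mul_right (setLIntegral_le_lintegral _ _) _

/-- The weak type `(1, 1)` inequality of Fefferman and Stein, for a weight `ν`: the maximal function of
`μ` is controlled by integrating the maximal function of `ν` against `μ`. -/
lemma mul_measure_lt_maxMeas_le (μ ν : Measure 𝔼) (t : ℝ≥0∞) :
    t * ν {x | t < maxMeas μ x} ≤ 5 ^ n * ∫⁻ x, maxMeas ν x ∂μ := by
  set S : ℕ → Set (𝔼 × ℝ) := fun R => {a : 𝔼 × ℝ | 0 < a.2 ∧ a.2 ≤ R ∧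
        t < μ (Metric.ball a.1 a.2) / volume (Metric.ball a.1 a.2)} with hS
  have hmono : Monotone fun R : ℕ => ⋃ a ∈ S R, Metric.ball a.1 a.2 := by
    intro R R' h
    refine Set.biUnion_subset_biUnion_left fun a ha => ⟨ha.1, ha.2.1.trans ?_, ha.2.2⟩
    exact_mod_cast h
  have hsub : {x | t < maxMeas μ x} ⊆ ⋃ R : ℕ, ⋃ a ∈ S R, Metric.ball a.1 a.2 := by
    intro x hx
    obtain ⟨y, r, hr, hxy, ht⟩ := lt_maxMeas_iff.1 hx
    obtain ⟨R, hR⟩ := exists_nat_ge r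
    simp only [Set.mem_iUnion]
    exact ⟨R, (y, r), ⟨hr, hR, ht⟩, hxy⟩
  calc t * ν {x | t < maxMeas μ x}
      ≤ t * ⨆ R : ℕ, ν (⋃ a ∈ S R, Metric.ball a.1 a.2) := by
        rw [← hmono.measure_iUnion]; gcongr
    _ = ⨆ R : ℕ, t * ν (⋃ a ∈ S R, Metric.ball a.1 a.2) := ENNReal.mul_iSup _ _
    _ ≤ _ := iSup_le fun R => measure_biUnion_ball_le μ ν R

lemma maxMeas_le_add {μ μ' : Measure 𝔼} {t : ℝ≥0∞}
    (h : ∀ y r, μ (Metric.ball y r) ≤ μ' (Metric.ball y r) + t * volume (Metric.ball y r)) (x : 𝔼) :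
    maxMeas μ x ≤ maxMeas μ' x + t := by
  refine iSup_le fun y => iSup_le fun r => iSup_le fun hr => iSup_le fun hx => ?_
  calc _ ≤ (μ' (Metric.ball y r) + t * volume (Metric.ball y r)) / volume (Metric.ball y r) := by
        gcongr; exact h y r
    _ = μ' (Metric.ball y r) / volume (Metric.ball y r) + t := by
        rw [ENNReal.add_div, ENNReal.mul_div_cancel_right (volume_ball_ne_zero y hr)
          (volume_ball_ne_top y r)]
    _ ≤ _ := by gcongr; exact le_maxMeas μ' hx

/-- The part of `u` below the height `t` adds at most `t` to the maximal function, so only the part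
above `t` enters the weak type inequality at height `2t`. -/
lemma measure_lt_maxMeas_withDensity_le (ν : Measure 𝔼) {u : 𝔼 → ℝ≥0∞} (hu : Measurable u)
    (t : ℝ≥0∞) (ht : t ≠ ∞) :
    t * ν {x | 2 * t < maxMeas (volume.withDensity u) x} ≤
      5 ^ n * ∫⁻ x in {x | t < u x}, u x * maxMeas ν x := by
  have hs : MeasurableSet {x | t < u x} := measurableSet_lt measurable_const hu
  set μ' := (volume : Measure 𝔼).withDensity ({x | t < u x}.indicator u) with hμ'
  have hle : ∀ x, maxMeas (volume.withDensity u) x ≤ maxMeas μ' x + t := by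
    refine maxMeas_le_add fun y r => ?_
    rw [withDensity_apply _ Metric.isOpen_ball.measurableSet, hμ',
      withDensity_apply _ Metric.isOpen_ball.measurableSet, ← setLIntegral_const,
      ← lintegral_add_right _ measurable_const]
    refine lintegral_mono fun x => ?_
    by_cases hx : t < u x
    · simp [hx]
    · simp [hx, not_lt.1 hx]
  calc t * ν {x | 2 * t < maxMeas (volume.withDensity u) x}
      ≤ t * ν {x | t < maxMeas μ' x} := by
        refine mul_le_mul_right (measure_mono fun x hx => ?_) t
        have := hx.trans_le (hle x)
        rw [two_mul] at this
        exact (ENNReal.add_lt_add_iff_right ht).1 this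
    _ ≤ 5 ^ n * ∫⁻ x, maxMeas ν x ∂μ' := mul_measure_lt_maxMeas_le μ' ν t
    _ = _ := by
        rw [hμ', lintegral_withDensity_eq_lintegral_mul _ (hu.indicator hs) (measurable_maxMeas ν),
          ← lintegral_indicator hs]
        congr 2 with x
        by_cases hx : t < u x <;> simp [hx]

/-! ### Weighted and vector-valued bounds -/

variable (n) in
/-- The weighted Fefferman–Stein inequality `∫ (M u)^q dν ≤ C ∫ u^q M ν`, for every measure `ν`. -/
lemma exists_lintegral_maxMeas_rpow_le {q : ℝ} (hq : 1 < q) :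
    ∃ C : ℝ≥0∞, C ≠ 0 ∧ C ≠ ∞ ∧ ∀ (ν : Measure 𝔼) (u : 𝔼 → ℝ≥0∞), Measurable u →
      ∫⁻ x, maxMeas (volume.withDensity u) x ^ q ∂ν ≤ C * ∫⁻ x, u x ^ q * maxMeas ν x := by
  obtain ⟨C, hC0, hC, hsum⟩ := exists_tsum_dyadic_le (θ := q - 1) (by linarith)
  have h40 : (4 : ℝ≥0∞) ^ q ≠ 0 := (ENNReal.rpow_pos (by simp) (by simp)).ne'
  have h4 : (4 : ℝ≥0∞) ^ q ≠ ∞ := ENNReal.rpow_ne_top_of_nonneg (by linarith) (by simp)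
  refine ⟨4 ^ q * 5 ^ n * C, by simp [hC0, h40],
    ENNReal.mul_ne_top (ENNReal.mul_ne_top h4 (by simp)) hC, fun ν u hu => ?_⟩
  have hs : ∀ k : ℤ, MeasurableSet {x | (2 : ℝ≥0∞) ^ k < u x} := fun k =>
    measurableSet_lt measurable_const hu
  have hM := measurable_maxMeas ν
  have huM : Measurable fun x => u x * maxMeas ν x := hu.mul hM
  have huqM : Measurable fun x => u x ^ q * maxMeas ν x := (hu.pow_const q).mul hM
  calc ∫⁻ x, maxMeas (volume.withDensity u) x ^ q ∂ν
      ≤ ∑' k : ℤ, ((2 : ℝ≥0∞) ^ (k + 1)) ^ q *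
          ν {x | (2 : ℝ≥0∞) ^ k < maxMeas (volume.withDensity u) x} :=
        lintegral_rpow_le_tsum ν (measurable_maxMeas _) (by linarith)
    _ = ∑' k : ℤ, ((2 : ℝ≥0∞) ^ (k + 1 + 1)) ^ q *
          ν {x | (2 : ℝ≥0∞) ^ (k + 1) < maxMeas (volume.withDensity u) x} :=
        ((Equiv.addRight (1 : ℤ)).tsum_eq _).symm
    _ ≤ ∑' k : ℤ, 4 ^ q * 5 ^ n * ∫⁻ x, (if (2 : ℝ≥0∞) ^ k < u x then
          ((2 : ℝ≥0∞) ^ k) ^ (q - 1) else 0) * (u x * maxMeas ν x) := by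
        refine ENNReal.tsum_le_tsum fun k => ?_
        set a : ℝ≥0∞ := 2 ^ k with ha
        have h2 : (2 : ℝ≥0∞) ^ (k + 1) = 2 * a := by
          rw [ENNReal.zpow_add (by simp) (by simp), zpow_one, mul_comm]
        have h3 : (2 : ℝ≥0∞) ^ (k + 1 + 1) = 4 * a := by
          rw [ENNReal.zpow_add (by simp) (by simp), zpow_one, h2]; ring
        rw [h2, h3]
        calc (4 * a) ^ q * ν {x | 2 * a < maxMeas (volume.withDensity u) x}
            = 4 ^ q * a ^ (q - 1) * (a * ν {x | 2 * a < maxMeas (volume.withDensity u) x}) := by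
              rw [ENNReal.mul_rpow_of_nonneg _ _ (by linarith), ← mul_rpow_sub_one (x := a) hq.le]
              ring
          _ ≤ 4 ^ q * a ^ (q - 1) * (5 ^ n * ∫⁻ x in {x | a < u x}, u x * maxMeas ν x) := by
              gcongr 4 ^ q * a ^ (q - 1) * ?_
              exact measure_lt_maxMeas_withDensity_le ν hu a (two_zpow_ne_top k)
          _ = 4 ^ q * 5 ^ n * ∫⁻ x in {x | a < u x}, a ^ (q - 1) * (u x * maxMeas ν x) := by
              rw [lintegral_const_mul _ huM]; ring
          _ = _ := by
              rw [← lintegral_indicator (hs k)]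
              congr 2 with x
              simp only [Set.indicator_apply, Set.mem_ofPred_eq, ite_mul, zero_mul]
              rfl
    _ = 4 ^ q * 5 ^ n * ∫⁻ x, (∑' k : ℤ, if (2 : ℝ≥0∞) ^ k < u x then
          ((2 : ℝ≥0∞) ^ k) ^ (q - 1) else 0) * (u x * maxMeas ν x) := by
        rw [ENNReal.tsum_mul_left, ← lintegral_tsum]
        · simp_rw [ENNReal.tsum_mul_right]
        · intro k
          exact ((Measurable.ite (hs k) measurable_const measurable_const).mul
            huM).aemeasurable
    _ ≤ 4 ^ q * 5 ^ n * ∫⁻ x, C * (u x ^ q * maxMeas ν x) := by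
        gcongr 4 ^ q * 5 ^ n * ?_
        refine lintegral_mono fun x => ?_
        calc _ ≤ (C * u x ^ (q - 1)) * (u x * maxMeas ν x) := by gcongr; exact hsum _
          _ = _ := by rw [← mul_rpow_sub_one hq.le]; ring
    _ = _ := by
        rw [lintegral_const_mul _ huqM]; ring

variable (n) in
/-- The vector-valued weak type `(r, r)` inequality for `r > q`. For a set `E` of finite measure inside
the level set, the weighted inequality with weight `1_E` can be summed over `j` and gives
`t^q |E| ≤ C ∫ |v|^q M 1_E`. Hölder with exponent `r / q` and the boundedness of `M` on the dual
space, applied to `1_E`, then bound `|E|`. -/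
lemma exists_measure_lt_lqNorm_maxMeas_le {q r : ℝ} (hq : 1 < q) (hqr : q < r) :
    ∃ C : ℝ≥0∞, C ≠ 0 ∧ C ≠ ∞ ∧ ∀ v : ℤ → 𝔼 → ℝ≥0∞, (∀ j, Measurable (v j)) →
      ∀ t : ℝ≥0∞, t ≠ 0 → t ≠ ∞ →
      volume {x | t < lqNorm q (fun j => maxMeas (volume.withDensity (v j)) x)} ≤
        C * t ^ (-r) * ∫⁻ x, lqNorm q (fun j => v j x) ^ r := by
  have hq0 : 0 < q := by linarith
  have hr0 : 0 < r := by linarith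
  obtain ⟨C₁, hC₁0, hC₁, h₁⟩ := exists_lintegral_maxMeas_rpow_le n hq
  -- `r / (r - q)` is the exponent dual to `r / q`
  have hs : 1 < r / (r - q) := by rw [one_lt_div (by linarith)]; linarith
  obtain ⟨C₂, hC₂0, hC₂, h₂⟩ := exists_lintegral_maxMeas_rpow_le n hs
  have hconj : (r / q).HolderConjugate (r / (r - q)) := by
    rw [Real.holderConjugate_iff]
    refine ⟨(one_lt_div hq0).2 hqr, ?_⟩
    field_simp
    ring
  have hθ : 0 < 1 / (r / (r - q)) := by positivity
  have hθ' : q / r + 1 / (r / (r - q)) = 1 := by field_simp; ring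
  set θ := 1 / (r / (r - q)) with hθdef
  have hC : C₁ * C₂ ^ θ ≠ ∞ := ENNReal.mul_ne_top hC₁ (ENNReal.rpow_ne_top_of_nonneg hθ.le hC₂)
  have hC0 : C₁ * C₂ ^ θ ≠ 0 :=
    mul_ne_zero hC₁0 (ENNReal.rpow_pos (pos_iff_ne_zero.2 hC₂0) hC₂).ne'
  refine ⟨(C₁ * C₂ ^ θ) ^ (r / q), (ENNReal.rpow_pos (pos_iff_ne_zero.2 hC0) hC).ne',
    ENNReal.rpow_ne_top_of_nonneg (by positivity) hC, fun v hv t ht0 ht => ?_⟩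
  set I := ∫⁻ x, lqNorm q (fun j => v j x) ^ r with hI
  have hmeasM : Measurable fun x => lqNorm q (fun j => maxMeas (volume.withDensity (v j)) x) :=
    measurable_lqNorm fun j => measurable_maxMeas _
  have hH : Measurable fun x => lqNorm q (fun j => v j x) := measurable_lqNorm hv
  -- the level set is not known to have finite measure, so it is tested from inside
  by_contra! hcon
  obtain ⟨E, hE, hEsub, hlt, hfin⟩ := Measure.exists_subset_measure_lt_top
    (measurableSet_lt measurable_const hmeasM) hcon
  refine absurd hlt (not_lt.2 ?_)
  set e := volume E with he
  have he0 : e ≠ 0 := (bot_le.trans_lt hlt).ne'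
  have hM := measurable_maxMeas (volume.restrict E)
  have hMs : ∫⁻ x, maxMeas (volume.restrict E) x ^ (r / (r - q)) ≤ C₂ * e := by
    have := h₂ volume (E.indicator 1) (measurable_const.indicator hE)
    rw [withDensity_indicator_one hE] at this
    refine this.trans ?_
    gcongr
    calc _ ≤ ∫⁻ x, E.indicator 1 x := by
          refine lintegral_mono fun x => ?_
          by_cases hx : x ∈ E
          · simpa [hx] using maxMeas_volume_le x
          · simp [hx, ENNReal.zero_rpow_of_pos (zero_lt_one.trans hs)]
      _ = e := lintegral_indicator_one hE
  have key : t ^ q * e ≤ C₁ * (I ^ (q / r) * (C₂ * e) ^ θ) := by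
    calc t ^ q * e = ∫⁻ x in E, t ^ q := by rw [setLIntegral_const]
      _ ≤ ∫⁻ x in E, ∑' j, maxMeas (volume.withDensity (v j)) x ^ q := by
          refine setLIntegral_mono
            (Measurable.tsum fun j => (measurable_maxMeas _).pow_const q) fun x hx => ?_
          rw [← lqNorm_rpow_self hq0]
          exact ENNReal.rpow_le_rpow (hEsub hx).le hq0.le
      _ = ∑' j, ∫⁻ x in E, maxMeas (volume.withDensity (v j)) x ^ q :=
          lintegral_tsum fun j => ((measurable_maxMeas _).pow_const q).aemeasurable
      _ ≤ ∑' j, C₁ * ∫⁻ x, v j x ^ q * maxMeas (volume.restrict E) x :=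
          ENNReal.tsum_le_tsum fun j => h₁ _ _ (hv j)
      _ = C₁ * ∫⁻ x, lqNorm q (fun j => v j x) ^ q * maxMeas (volume.restrict E) x := by
          rw [ENNReal.tsum_mul_left]
          simp_rw [lqNorm_rpow_self hq0, ← ENNReal.tsum_mul_right]
          have hm : ∀ j, Measurable fun x => v j x ^ q * maxMeas (volume.restrict E) x :=
            fun j => ((hv j).pow_const q).mul hM
          rw [lintegral_tsum fun j => (hm j).aemeasurable]
      _ ≤ C₁ * ((∫⁻ x, (lqNorm q (fun j => v j x) ^ q) ^ (r / q)) ^ (1 / (r / q)) *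
            (∫⁻ x, maxMeas (volume.restrict E) x ^ (r / (r - q))) ^ θ) := by
          gcongr
          exact ENNReal.lintegral_mul_le_Lp_mul_Lq _ hconj (hH.pow_const q).aemeasurable
            hM.aemeasurable
      _ ≤ _ := by
          gcongr C₁ * (?_ * ?_)
          · simp_rw [← ENNReal.rpow_mul, mul_div_cancel₀ r hq0.ne', one_div_div]
            exact le_rfl
          · exact ENNReal.rpow_le_rpow hMs hθ.le
  have hqr0 : 0 ≤ q / r := by positivity
  have heθ0 : e ^ θ ≠ 0 := (ENNReal.rpow_pos (pos_iff_ne_zero.2 he0) hfin.ne).ne'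
  have heθ : e ^ θ ≠ ∞ := ENNReal.rpow_ne_top_of_nonneg hθ.le hfin.ne
  have key2 : t ^ q * e ^ (q / r) ≤ C₁ * C₂ ^ θ * I ^ (q / r) := by
    rw [← ENNReal.mul_le_mul_iff_left heθ0 heθ]
    calc t ^ q * e ^ (q / r) * e ^ θ = t ^ q * e := by
          rw [mul_assoc, ← ENNReal.rpow_add_of_nonneg _ _ hqr0 hθ.le, hθ', ENNReal.rpow_one]
      _ ≤ _ := key
      _ = _ := by rw [ENNReal.mul_rpow_of_nonneg _ _ hθ.le]; ring
  have key3 := ENNReal.rpow_le_rpow key2 (z := r / q) (by positivity)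
  rw [ENNReal.mul_rpow_of_nonneg _ _ (by positivity), ENNReal.mul_rpow_of_nonneg _ _ (by positivity),
    ← ENNReal.rpow_mul, ← ENNReal.rpow_mul, ← ENNReal.rpow_mul, mul_div_cancel₀ r hq0.ne',
    div_mul_div_cancel₀ hr0.ne', div_self hq0.ne', ENNReal.rpow_one, ENNReal.rpow_one] at key3
  have htr : t ^ (-r) * t ^ r = 1 := by
    rw [← ENNReal.rpow_add _ _ ht0 ht]; simp
  calc e = t ^ (-r) * (t ^ r * e) := by rw [← mul_assoc, htr, one_mul]
    _ ≤ t ^ (-r) * ((C₁ * C₂ ^ θ) ^ (r / q) * I) := by gcongr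
    _ = _ := by ring

variable (n) in
/-- The maximal operator maps weak `L^p` to itself for `p > 1`. -/
lemma exists_measure_lt_maxMeas_le {p : ℝ} (hp : 1 < p) :
    ∃ C : ℝ≥0∞, C ≠ ∞ ∧ ∀ G : 𝔼 → ℝ≥0∞, Measurable G → ∀ A : ℝ≥0∞,
      (∀ s : ℝ≥0∞, s ≠ 0 → s ≠ ∞ → volume {x | s < G x} ≤ A * s ^ (-p)) →
      ∀ t : ℝ≥0∞, t ≠ 0 → t ≠ ∞ →
        volume {x | 2 * t < maxMeas (volume.withDensity G) x} ≤ C * A * t ^ (-p) := by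
  obtain ⟨C₁, -, hC₁, h₁⟩ := exists_tsum_dyadic_le (θ := 1) one_pos
  obtain ⟨C₂, -, hC₂, h₂⟩ := exists_tsum_dyadic_le (θ := p - 1) (by linarith)
  refine ⟨5 ^ n * (2 * (2 * C₁ + C₂)), by finiteness, fun G hG A hA t ht0 ht => ?_⟩
  have hs : MeasurableSet {x | t < G x} := measurableSet_lt measurable_const hG
  have hint : ∫⁻ x in {x | t < G x}, G x ≤ 2 * (2 * C₁ + C₂) * A * (t * t ^ (-p)) := by
    calc ∫⁻ x in {x | t < G x}, G x = ∫⁻ x, ({x | t < G x}.indicator G x) ^ (1 : ℝ) := by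
          simp_rw [ENNReal.rpow_one]; rw [lintegral_indicator hs]
      _ ≤ ∑' k : ℤ, ((2 : ℝ≥0∞) ^ (k + 1)) ^ (1 : ℝ) *
            volume {x | (2 : ℝ≥0∞) ^ k < {x | t < G x}.indicator G x} :=
          lintegral_rpow_le_tsum _ (hG.indicator hs) one_pos
      _ ≤ ∑' k : ℤ, 2 * A * ((if (2 : ℝ≥0∞) ^ k < 2 * t then ((2 : ℝ≥0∞) ^ k) ^ (1 : ℝ) else 0) *
            t ^ (-p) + if (2 : ℝ≥0∞) ^ (-k) < t⁻¹ then ((2 : ℝ≥0∞) ^ (-k)) ^ (p - 1) else 0) := by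
          refine ENNReal.tsum_le_tsum fun k => ?_
          rw [ENNReal.zpow_add (by simp) (by simp), zpow_one, ENNReal.zpow_neg, ENNReal.rpow_one,
            ENNReal.rpow_one]
          have ha0 := two_zpow_ne_zero k
          have hat := two_zpow_ne_top k
          set a : ℝ≥0∞ := 2 ^ k
          -- a low layer of the truncation is contained in `{t < G}`, a high one in `{a < G}`
          rcases lt_or_ge a (2 * t) with hk | hk
          · rw [if_pos hk]
            calc a * 2 * volume {x | a < {x | t < G x}.indicator G x}
                ≤ a * 2 * (A * t ^ (-p)) := by
                  gcongr
                  refine (measure_mono fun x hx => ?_).trans (hA t ht0 ht)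
                  by_contra hcon
                  rw [Set.mem_ofPred_eq, Set.indicator_of_notMem hcon] at hx
                  exact absurd hx (by simp)
              _ = 2 * A * (a * t ^ (-p)) := by ring
              _ ≤ _ := by gcongr; exact le_self_add
          · have htk : t < a := by
              refine lt_of_lt_of_le ?_ hk
              rw [two_mul]
              exact ENNReal.lt_add_right ht ht0
            rw [if_pos (ENNReal.inv_lt_inv.2 htk)]
            have haa : a * a ^ (-p) = a⁻¹ ^ (p - 1) := by
              rw [ENNReal.inv_rpow, ← ENNReal.rpow_neg]
              conv_lhs => rw [← ENNReal.rpow_one a, ← ENNReal.rpow_mul, one_mul]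
              rw [← ENNReal.rpow_add _ _ ha0 hat]
              congr 1
              ring
            calc a * 2 * volume {x | a < {x | t < G x}.indicator G x}
                ≤ a * 2 * (A * a ^ (-p)) := by
                  gcongr
                  refine (measure_mono fun x hx => ?_).trans (hA a ha0 hat)
                  have hx' : a < {x | t < G x}.indicator G x := hx
                  exact hx'.trans_le (Set.indicator_le_self _ _ x)
              _ = 2 * A * (a⁻¹ ^ (p - 1)) := by rw [← haa]; ring
              _ ≤ _ := by gcongr; exact le_add_self
      _ = 2 * A * ((∑' k : ℤ, if (2 : ℝ≥0∞) ^ k < 2 * t then ((2 : ℝ≥0∞) ^ k) ^ (1 : ℝ) else 0) *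
            t ^ (-p) + ∑' k : ℤ, if (2 : ℝ≥0∞) ^ k < t⁻¹ then ((2 : ℝ≥0∞) ^ k) ^ (p - 1) else 0) := by
          rw [ENNReal.tsum_mul_left, ENNReal.tsum_add, ENNReal.tsum_mul_right]
          congr 2
          exact (Equiv.neg ℤ).tsum_eq
            (fun k : ℤ => if (2 : ℝ≥0∞) ^ k < t⁻¹ then ((2 : ℝ≥0∞) ^ k) ^ (p - 1) else 0)
      _ ≤ 2 * A * (C₁ * (2 * t) ^ (1 : ℝ) * t ^ (-p) + C₂ * t⁻¹ ^ (p - 1)) := by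
          gcongr
          · exact h₁ _
          · exact h₂ _
      _ = _ := by
          have htt : t⁻¹ ^ (p - 1) = t * t ^ (-p) := by
            rw [ENNReal.inv_rpow, ← ENNReal.rpow_neg]
            conv_rhs => rw [← ENNReal.rpow_one t, ← ENNReal.rpow_mul, one_mul]
            rw [← ENNReal.rpow_add _ _ ht0 ht]
            congr 1
            ring
          rw [htt, ENNReal.rpow_one]
          ring
  rw [← ENNReal.mul_le_mul_iff_right ht0 ht]
  calc t * volume {x | 2 * t < maxMeas (volume.withDensity G) x}
      ≤ 5 ^ n * ∫⁻ x in {x | t < G x}, G x * maxMeas volume x :=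
        measure_lt_maxMeas_withDensity_le volume hG t ht
    _ ≤ 5 ^ n * ∫⁻ x in {x | t < G x}, G x := by
        gcongr with x
        exact mul_le_of_le_one_right' (maxMeas_volume_le x)
    _ ≤ 5 ^ n * (2 * (2 * C₁ + C₂) * A * (t * t ^ (-p))) := by gcongr
    _ = _ := by ring

/-! ### Whitney averages -/

open scoped Classical in
/-- The average of `u`, at each point `y` of `Ω`, over the ball around `y` whose radius is half the
distance to the complement of `Ω`; outside `Ω` the function `u` itself. It replaces the
Calderón–Zygmund averaging over Whitney cubes. It is meant for open `Ω ≠ ℝⁿ`; if `Ω = ℝⁿ` then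
`Metric.infDist` is `0` and so is the average. -/
noncomputable def whitneyAvg (Ω : Set 𝔼) (u : 𝔼 → ℝ≥0∞) (y : 𝔼) : ℝ≥0∞ :=
  if y ∈ Ω then (∫⁻ z in Metric.ball y (Metric.infDist y Ωᶜ / 2), u z) /
    volume (Metric.ball y (Metric.infDist y Ωᶜ / 2)) else u y

lemma measurable_lintegral_ball {ρ : 𝔼 → ℝ} (hρ : Measurable ρ) {F : 𝔼 → 𝔼 → ℝ≥0∞}
    (hF : Measurable (Function.uncurry F)) :
    Measurable fun y => ∫⁻ z in Metric.ball y (ρ y), F y z := by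
  have hs : MeasurableSet {p : 𝔼 × 𝔼 | dist p.2 p.1 < ρ p.1} :=
    measurableSet_lt (measurable_snd.dist measurable_fst) (hρ.comp measurable_fst)
  have := (hF.indicator hs).lintegral_prod_right' (ν := (volume : Measure 𝔼))
  convert this using 2 with y
  rw [← lintegral_indicator Metric.isOpen_ball.measurableSet]
  rfl

lemma measurable_volume_ball {ρ : 𝔼 → ℝ} (hρ : Measurable ρ) :
    Measurable fun y : 𝔼 => volume (Metric.ball y (ρ y)) := by
  simpa using measurable_lintegral_ball hρ (F := fun _ _ => 1) measurable_const

lemma measurable_whitneyAvg {Ω : Set 𝔼} (hΩ : IsOpen Ω) {u : 𝔼 → ℝ≥0∞} (hu : Measurable u) :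
    Measurable (whitneyAvg Ω u) := by
  have hρ : Measurable fun y : 𝔼 => Metric.infDist y Ωᶜ / 2 :=
    (Metric.continuous_infDist_pt _).measurable.div_const 2
  exact Measurable.ite hΩ.measurableSet ((measurable_lintegral_ball hρ
    (F := fun _ z => u z) (hu.comp measurable_snd)).div (measurable_volume_ball hρ)) hu

lemma infDist_compl_pos {Ω : Set 𝔼} (hΩ : IsOpen Ω) (hne : Ωᶜ.Nonempty) {y : 𝔼} (hy : y ∈ Ω) :
    0 < Metric.infDist y Ωᶜ :=
  (hΩ.isClosed_compl.notMem_iff_infDist_pos hne).1 (by simpa using hy)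

/-- The total weight with which the value at `z` enters the Whitney averages over `2B` is bounded
below, if the ball `B` contains `z` and leaves `Ω`. If `d` is the distance of `z` to the complement,
every `y` within `d / 4` of `z` contributes: its own distance to the complement is between `3d / 4`
and `5d / 4`, so its averaging ball contains `z` and has volume at most `4 ^ n` times that of the ball
of radius `d / 4`. -/
lemma one_le_lintegral_whitney {Ω : Set 𝔼} (hΩ : IsOpen Ω) {x c z : 𝔼} {r : ℝ} (hx : x ∉ Ω)
    (hxc : x ∈ Metric.ball c r) (hzc : z ∈ Metric.ball c r) (hz : z ∈ Ω) :
    1 ≤ 4 ^ n * ∫⁻ y in Metric.ball c (2 * r) ∩ Ω,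
      (Metric.ball y (Metric.infDist y Ωᶜ / 2)).indicator
        (fun _ => (volume (Metric.ball y (Metric.infDist y Ωᶜ / 2)))⁻¹) z := by
  set d := Metric.infDist z Ωᶜ with hd
  have hd0 : 0 < d := infDist_compl_pos hΩ ⟨x, hx⟩ hz
  have hdr : d < 2 * r := by
    calc d ≤ dist z x := Metric.infDist_le_dist_of_mem hx
      _ ≤ dist z c + dist x c := dist_triangle_right _ _ _
      _ < 2 * r := by rw [Metric.mem_ball] at hxc hzc; linarith
  have hV0 := volume_ball_ne_zero z (r := d / 4) (by positivity)
  have hVt := volume_ball_ne_top z (d / 4)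
  set V := volume (Metric.ball z (d / 4)) with hV
  have hnear : ∀ y ∈ Metric.ball z (d / 4), 3 / 4 * d < Metric.infDist y Ωᶜ ∧
      Metric.infDist y Ωᶜ < 5 / 4 * d := by
    intro y hy
    have h1 : Metric.infDist z Ωᶜ ≤ Metric.infDist y Ωᶜ + dist z y :=
      Metric.infDist_le_infDist_add_dist
    have h2 : Metric.infDist y Ωᶜ ≤ Metric.infDist z Ωᶜ + dist y z :=
      Metric.infDist_le_infDist_add_dist
    rw [dist_comm] at h1
    rw [Metric.mem_ball] at hy
    constructor <;> linarith
  have hsub : Metric.ball z (d / 4) ⊆ Metric.ball c (2 * r) ∩ Ω := by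
    intro y hy
    refine ⟨?_, ?_⟩
    · have := dist_triangle y z c
      rw [Metric.mem_ball] at hy hzc ⊢
      linarith
    · by_contra hcon
      have := (hnear y hy).1
      rw [Metric.infDist_zero_of_mem (s := Ωᶜ) hcon] at this
      linarith
  calc (1 : ℝ≥0∞) = 4 ^ n * ∫⁻ y in Metric.ball z (d / 4), (4 ^ n * V)⁻¹ := by
        rw [setLIntegral_const, mul_comm _ (volume _), ← mul_assoc,
          ENNReal.mul_inv_cancel (by simp [hV0]) (ENNReal.mul_ne_top (by simp) hVt)]
    _ ≤ 4 ^ n * ∫⁻ y in Metric.ball z (d / 4),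
      (Metric.ball y (Metric.infDist y Ωᶜ / 2)).indicator
        (fun _ => (volume (Metric.ball y (Metric.infDist y Ωᶜ / 2)))⁻¹) z := by
        gcongr 4 ^ n * ?_
        refine setLIntegral_mono' Metric.isOpen_ball.measurableSet fun y hy => ?_
        obtain ⟨h1, h2⟩ := hnear y hy
        have hzy : z ∈ Metric.ball y (Metric.infDist y Ωᶜ / 2) := by
          rw [Metric.mem_ball, dist_comm]
          rw [Metric.mem_ball] at hy
          linarith
        rw [Set.indicator_of_mem hzy, ENNReal.inv_le_inv]
        calc volume (Metric.ball y (Metric.infDist y Ωᶜ / 2))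
            ≤ volume (Metric.ball y (4 * (d / 4))) :=
              measure_mono (Metric.ball_subset_ball (by linarith))
          _ = 4 ^ n * V := by
              rw [volume_ball_mul y z (by norm_num) (by positivity)]; simp [hV]
    _ ≤ _ := by gcongr 4 ^ n * ?_; exact lintegral_mono_set hsub

/-- Off `Ω`, replacing `u` by its Whitney averages does not decrease the maximal function by more than
a constant factor: by Tonelli and `one_le_lintegral_whitney`, the mass of `u` in a ball `B` is bounded
by that of the averages in `2B`. -/
lemma maxMeas_le_whitneyAvg {Ω : Set 𝔼} (hΩ : IsOpen Ω) {u : 𝔼 → ℝ≥0∞} (hu : Measurable u)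
    {x : 𝔼} (hx : x ∉ Ω) :
    maxMeas (volume.withDensity u) x ≤ 8 ^ n * maxMeas (volume.withDensity (whitneyAvg Ω u)) x := by
  refine iSup_le fun c => iSup_le fun r => iSup_le fun hr => iSup_le fun hxc => ?_
  set d : 𝔼 → ℝ := fun y => Metric.infDist y Ωᶜ / 2 with hd
  have hdm : Measurable d := (Metric.continuous_infDist_pt _).measurable.div_const 2
  have hBm : ∀ y ρ, MeasurableSet (Metric.ball (y : 𝔼) ρ) := fun y ρ =>
    Metric.isOpen_ball.measurableSet
  set B := Metric.ball c r with hB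
  set B' := Metric.ball c (2 * r) with hB'
  have hBB' : B ⊆ B' := Metric.ball_subset_ball (by linarith)
  set K : 𝔼 → 𝔼 → ℝ≥0∞ := fun y z =>
    (Metric.ball y (d y)).indicator (fun _ => (volume (Metric.ball y (d y)))⁻¹) z with hK
  have hKm : Measurable (Function.uncurry K) := by
    have hs : MeasurableSet {p : 𝔼 × 𝔼 | dist p.2 p.1 < d p.1} :=
      measurableSet_lt (measurable_snd.dist measurable_fst) (hdm.comp measurable_fst)
    exact ((measurable_volume_ball hdm).inv.comp measurable_fst).indicator hs
  have hin : ∫⁻ z in B ∩ Ω, u z ≤ 4 ^ n * ∫⁻ y in B' ∩ Ω, whitneyAvg Ω u y := by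
    calc ∫⁻ z in B ∩ Ω, u z ≤ ∫⁻ z in B ∩ Ω, 4 ^ n * ∫⁻ y in B' ∩ Ω, K y z * u z := by
          refine setLIntegral_mono' ((hBm _ _).inter hΩ.measurableSet) fun z hz => ?_
          have hKz : Measurable fun y => K y z := hKm.of_uncurry_right
          rw [lintegral_mul_const _ hKz, ← mul_assoc]
          exact le_mul_of_one_le_left' (one_le_lintegral_whitney hΩ hx hxc hz.1 hz.2)
      _ ≤ ∫⁻ z, 4 ^ n * ∫⁻ y in B' ∩ Ω, K y z * u z := setLIntegral_le_lintegral _ _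
      _ = 4 ^ n * ∫⁻ z, ∫⁻ y in B' ∩ Ω, K y z * u z := by
          rw [lintegral_const_mul' _ _ (by simp)]
      _ = 4 ^ n * ∫⁻ y in B' ∩ Ω, ∫⁻ z, K y z * u z := by
          rw [lintegral_lintegral_swap]
          exact ((hKm.comp measurable_swap).mul (hu.comp measurable_fst)).aemeasurable
      _ = _ := by
          congr 1
          refine setLIntegral_congr_fun ((hBm _ _).inter hΩ.measurableSet) fun y hy => ?_
          simp only [whitneyAvg, if_pos hy.2]
          rw [ENNReal.div_eq_inv_mul, ← lintegral_const_mul _ hu, ← lintegral_indicator (hBm _ _)]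
          refine lintegral_congr fun z => ?_
          by_cases hz : z ∈ Metric.ball y (Metric.infDist y Ωᶜ / 2) <;> simp [hK, hd, hz]
  have hout : ∫⁻ z in B \ Ω, u z ≤ 4 ^ n * ∫⁻ y in B' \ Ω, whitneyAvg Ω u y := by
    calc ∫⁻ z in B \ Ω, u z = ∫⁻ z in B \ Ω, whitneyAvg Ω u z := by
          refine setLIntegral_congr_fun ((hBm _ _).diff hΩ.measurableSet) fun y hy => ?_
          simp only [whitneyAvg, if_neg hy.2]
      _ ≤ ∫⁻ z in B' \ Ω, whitneyAvg Ω u z := lintegral_mono_set (Set.sdiff_subset_sdiff_left hBB')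
      _ ≤ _ := le_mul_of_one_le_left' (one_le_pow₀ (by norm_num))
  have htot : ∫⁻ z in B, u z ≤ 4 ^ n * ∫⁻ y in B', whitneyAvg Ω u y := by
    rw [← lintegral_inter_add_sdiff u B hΩ.measurableSet,
      ← lintegral_inter_add_sdiff (whitneyAvg Ω u) B' hΩ.measurableSet, mul_add]
    exact add_le_add hin hout
  have hvol : volume B' = 2 ^ n * volume B := by
    rw [hB', volume_ball_mul c c (by norm_num) hr]; simp [hB]
  have h2 : (2 : ℝ≥0∞) ^ n ≠ 0 := by simp
  rw [withDensity_apply _ (hBm _ _)]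
  calc (∫⁻ z in B, u z) / volume B
      ≤ (4 ^ n * ∫⁻ y in B', whitneyAvg Ω u y) / volume B := by gcongr
    _ = 8 ^ n * ((∫⁻ y in B', whitneyAvg Ω u y) / volume B') := by
        rw [hvol, ← ENNReal.mul_div_mul_left _ (volume B) h2 (by simp), ← mul_assoc, ← mul_pow,
          mul_div_assoc]
        norm_num
    _ ≤ _ := by
        gcongr 8 ^ n * ?_
        rw [← withDensity_apply _ (hBm _ _)]
        exact le_maxMeas _ (hBB' hxc)

/-- The Whitney averages are bounded if the sequence and the maximal function of its `ℓ^q` norm are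
bounded off `Ω`: the averaging ball of `y ∈ Ω` is contained in a ball of four times its radius which
meets the complement. -/
lemma lqNorm_whitneyAvg_le {Ω : Set 𝔼} (hΩ : IsOpen Ω) (hne : Ωᶜ.Nonempty) {q : ℝ} (hq : 1 < q)
    {u : ℤ → 𝔼 → ℝ≥0∞} (hu : ∀ j, Measurable (u j)) {t : ℝ≥0∞}
    (ht : ∀ x ∉ Ω, lqNorm q (fun j => u j x) ≤ t)
    (htM : ∀ x ∉ Ω, maxMeas (volume.withDensity fun x => lqNorm q (fun j => u j x)) x ≤ t) (y : 𝔼) :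
    lqNorm q (fun j => whitneyAvg Ω (u j) y) ≤ 4 ^ n * t := by
  by_cases hy : y ∈ Ω
  · simp only [whitneyAvg, if_pos hy]
    set d := Metric.infDist y Ωᶜ with hd
    have hd0 : 0 < d := infDist_compl_pos hΩ hne hy
    set V := volume (Metric.ball y (d / 2)) with hV
    obtain ⟨x, hx, hxy⟩ := (Metric.infDist_lt_iff hne).1 (show Metric.infDist y Ωᶜ < 4 * (d / 2) by
      linarith)
    have hvol : volume (Metric.ball y (4 * (d / 2))) = 4 ^ n * V := by
      rw [volume_ball_mul y y (by norm_num) (by positivity)]; simp [hV]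
    calc lqNorm q (fun j => (∫⁻ z in Metric.ball y (d / 2), u j z) / V)
        = V⁻¹ * lqNorm q (fun j => ∫⁻ z in Metric.ball y (d / 2), u j z) := by
          rw [← lqNorm_const_mul (by linarith)]
          simp_rw [ENNReal.div_eq_inv_mul]
      _ ≤ V⁻¹ * ∫⁻ z in Metric.ball y (d / 2), lqNorm q (fun j => u j z) := by
          gcongr V⁻¹ * ?_
          exact lqNorm_lintegral_le _ hq hu
      _ ≤ V⁻¹ * ∫⁻ z in Metric.ball y (4 * (d / 2)), lqNorm q (fun j => u j z) := by
          gcongr V⁻¹ * ?_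
          exact lintegral_mono_set (Metric.ball_subset_ball (by linarith))
      _ = 4 ^ n * ((volume.withDensity fun x => lqNorm q (fun j => u j x))
            (Metric.ball y (4 * (d / 2))) / volume (Metric.ball y (4 * (d / 2)))) := by
          rw [withDensity_apply _ Metric.isOpen_ball.measurableSet, hvol,
            ← mul_div_assoc (4 ^ n : ℝ≥0∞), ENNReal.mul_div_mul_left _ _ (by simp) (by simp), ENNReal.div_eq_inv_mul]
      _ ≤ _ := by
          gcongr 4 ^ n * ?_
          exact (le_maxMeas _ (by rwa [Metric.mem_ball, dist_comm])).trans (htM x hx)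
  · simp only [whitneyAvg, if_neg hy]
    exact (ht y hy).trans (le_mul_of_one_le_left' (one_le_pow₀ (by norm_num)))

/-! ### The weak type inequality -/

variable (n) in
/-- The distributional form of the Fefferman–Stein inequality in weak `L^p(ℓ^q)`. -/
lemma exists_measure_lt_lqNorm_maxMeas_le_of_weak {p q : ℝ} (hp : 1 < p) (hq : 1 < q) :
    ∃ C : ℝ≥0∞, C ≠ ∞ ∧ ∀ u : ℤ → 𝔼 → ℝ≥0∞, (∀ j, Measurable (u j)) → ∀ A : ℝ≥0∞, A ≠ 0 →
      (∀ s : ℝ≥0∞, s ≠ 0 → s ≠ ∞ →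
        volume {x | s < lqNorm q (fun j => u j x)} ≤ A * s ^ (-p)) →
      ∀ t : ℝ≥0∞, t ≠ 0 → t ≠ ∞ →
        volume {x | t < lqNorm q (fun j => maxMeas (volume.withDensity (u j)) x)} ≤
          C * A * t ^ (-p) := by
  obtain ⟨C₁, hC₁, h₁⟩ := exists_measure_lt_maxMeas_le n hp
  obtain ⟨C₂, -, hC₂, h₂⟩ := exists_measure_lt_lqNorm_maxMeas_le n hq (r := p + q) (by linarith)
  obtain ⟨C₃, hC₃, h₃⟩ := exists_lintegral_rpow_le_of_le (volume : Measure 𝔼) (p := p) (r := p + q)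
    (by linarith) (by linarith)
  set κ : ℝ≥0∞ := 4 ^ n * 2 with hκ
  have hκ0 : κ ≠ 0 := by simp [hκ]
  have hκt : κ ≠ ∞ := by rw [hκ]; finiteness
  have hκp : κ ^ p ≠ ∞ := ENNReal.rpow_ne_top_of_nonneg (by linarith) hκt
  have hκq : κ ^ q ≠ ∞ := ENNReal.rpow_ne_top_of_nonneg (by linarith) hκt
  have h8 : ((8 : ℝ≥0∞) ^ n) ^ p ≠ ∞ := ENNReal.rpow_ne_top_of_nonneg (by linarith) (by simp)
  set D := 1 + (C₁ + 2) * κ ^ p with hD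
  have hDt : D ≠ ∞ := by rw [hD]; finiteness
  refine ⟨(C₁ + 2 + C₂ * C₃ * D * κ ^ q) * ((8 : ℝ≥0∞) ^ n) ^ p, by finiteness,
    fun u hu A hA0 hA => ?_⟩
  set G : 𝔼 → ℝ≥0∞ := fun x => lqNorm q (fun j => u j x) with hG
  have hGm : Measurable G := measurable_lqNorm hu
  -- it suffices to treat the level `8 ^ n * t`
  suffices hmain : ∀ t : ℝ≥0∞, t ≠ 0 → t ≠ ∞ →
      volume {x | 8 ^ n * t < lqNorm q (fun j => maxMeas (volume.withDensity (u j)) x)} ≤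
        (C₁ + 2 + C₂ * C₃ * D * κ ^ q) * A * t ^ (-p) by
    intro t ht0 ht
    have h80 : (8 : ℝ≥0∞) ^ n ≠ 0 := by simp
    have h8t : (8 : ℝ≥0∞) ^ n ≠ ∞ := by simp
    have h := hmain (((8 : ℝ≥0∞) ^ n)⁻¹ * t) (mul_ne_zero (ENNReal.inv_ne_zero.2 h8t) ht0)
      (ENNReal.mul_ne_top (ENNReal.inv_ne_top.2 h80) ht)
    rw [← mul_assoc, ENNReal.mul_inv_cancel h80 h8t, one_mul,
      ENNReal.mul_rpow_of_ne_top (ENNReal.inv_ne_top.2 h80) ht, ENNReal.inv_rpow,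
      ← ENNReal.rpow_neg, neg_neg] at h
    refine h.trans (le_of_eq ?_)
    ring
  intro t ht0 ht
  have htp0 : t ^ (-p) ≠ 0 := (ENNReal.rpow_pos (pos_iff_ne_zero.2 ht0) ht).ne'
  obtain ⟨Ω, hsub, hΩ, hΩvol⟩ := Set.exists_isOpen_le_add
    ({x | 2 * t < G x} ∪ {x | 2 * t < maxMeas (volume.withDensity G) x}) (volume : Measure 𝔼)
    (ε := A * t ^ (-p)) (mul_ne_zero hA0 htp0)
  have hΩle : volume Ω ≤ (C₁ + 2) * A * t ^ (-p) := by
    calc volume Ω ≤ (A * t ^ (-p) + C₁ * A * t ^ (-p)) + A * t ^ (-p) := by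
          refine hΩvol.trans ?_
          gcongr ?_ + _
          refine (measure_union_le _ _).trans (add_le_add ?_ (h₁ G hGm A hA t ht0 ht))
          refine (measure_mono fun x hx => ?_).trans (hA t ht0 ht)
          have hx' : 2 * t < G x := hx
          exact lt_of_le_of_lt (by rw [two_mul]; exact le_self_add) hx'
      _ = _ := by ring
  rcases Ωᶜ.eq_empty_or_nonempty with hemp | hne
  · rw [Set.compl_empty_iff] at hemp
    calc _ ≤ volume Ω := by rw [hemp]; exact measure_mono (Set.subset_univ _)
      _ ≤ (C₁ + 2) * A * t ^ (-p) := hΩle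
      _ ≤ _ := by gcongr ?_ * _ * _; exact le_self_add
  -- `h` has `ℓ^q` norm at most `T` and still satisfies the weak `L^p` bound
  set h : ℤ → 𝔼 → ℝ≥0∞ := fun j => whitneyAvg Ω (u j) with hh
  have hhm : ∀ j, Measurable (h j) := fun j => measurable_whitneyAvg hΩ (hu j)
  set H : 𝔼 → ℝ≥0∞ := fun x => lqNorm q (fun j => h j x) with hH
  set T := κ * t with hT
  have hT' : T = 4 ^ n * (2 * t) := by rw [hT, hκ, mul_assoc]
  have hHT : ∀ x, H x ≤ T := by
    rw [hT']
    refine lqNorm_whitneyAvg_le hΩ hne hq hu (fun x hx => ?_) (fun x hx => ?_)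
    · by_contra! hcon
      exact hx (hsub (Or.inl hcon))
    · by_contra! hcon
      exact hx (hsub (Or.inr hcon))
  have htT : t ^ (-p) = κ ^ p * T ^ (-p) := by
    rw [hT, ENNReal.mul_rpow_of_ne_top hκt ht, ← mul_assoc, ← ENNReal.rpow_add _ _ hκ0 hκt]
    simp
  have hHweak : ∀ s : ℝ≥0∞, s ≠ 0 → s ≠ ∞ → volume {x | s < H x} ≤ (A * D) * s ^ (-p) := by
    intro s hs0 hs
    rcases lt_or_ge s T with hsT | hsT
    · calc volume {x | s < H x} ≤ volume ({x | s < G x} ∪ Ω) := by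
            refine measure_mono fun x hx => ?_
            by_cases hxΩ : x ∈ Ω
            · exact Or.inr hxΩ
            · left
              have hx' : s < H x := hx
              have hHG : H x = G x := by simp only [hH, hG, hh, whitneyAvg, if_neg hxΩ]
              exact lt_of_lt_of_eq hx' hHG
        _ ≤ A * s ^ (-p) + (C₁ + 2) * A * t ^ (-p) :=
            (measure_union_le _ _).trans (add_le_add (hA s hs0 hs) hΩle)
        _ ≤ A * s ^ (-p) + (C₁ + 2) * A * (κ ^ p * s ^ (-p)) := by
            rw [htT]
            gcongr _ + _ * (_ * ?_)
            rw [ENNReal.rpow_neg, ENNReal.rpow_neg, ENNReal.inv_le_inv]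
            exact ENNReal.rpow_le_rpow hsT.le (by linarith)
        _ = _ := by rw [hD]; ring
    · have : {x | s < H x} = ∅ := by
        ext x
        simpa using (hHT x).trans hsT
      simp [this]
  -- hence `h` lies in `L^{p + q}(ℓ^q)`, where the exponent exceeds both `p` and `q`
  have hgood : volume {x | t < lqNorm q (fun j => maxMeas (volume.withDensity (h j)) x)} ≤
      C₂ * C₃ * D * κ ^ q * A * t ^ (-p) := by
    calc _ ≤ C₂ * t ^ (-(p + q)) * ∫⁻ x, H x ^ (p + q) := h₂ h hhm t ht0 ht
      _ ≤ C₂ * t ^ (-(p + q)) * (C₃ * (A * D) * T ^ (p + q - p)) := by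
          gcongr
          exact h₃ H (measurable_lqNorm hhm) (A * D) T hHT hHweak
      _ = C₂ * C₃ * D * κ ^ q * A * (t ^ (-(p + q)) * t ^ q) := by
          rw [add_sub_cancel_left, hT, ENNReal.mul_rpow_of_nonneg _ _ (by linarith)]; ring
      _ = _ := by rw [← ENNReal.rpow_add _ _ ht0 ht]; congr 2; ring
  calc volume {x | 8 ^ n * t < lqNorm q (fun j => maxMeas (volume.withDensity (u j)) x)}
      ≤ volume (Ω ∪ {x | t < lqNorm q (fun j => maxMeas (volume.withDensity (h j)) x)}) := by
        refine measure_mono fun x hx => ?_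
        by_cases hxΩ : x ∈ Ω
        · exact Or.inl hxΩ
        · right
          have hle : lqNorm q (fun j => maxMeas (volume.withDensity (u j)) x) ≤
              8 ^ n * lqNorm q (fun j => maxMeas (volume.withDensity (h j)) x) := by
            rw [← lqNorm_const_mul (by linarith)]
            exact lqNorm_mono (by linarith) fun j => maxMeas_le_whitneyAvg hΩ (hu j) hxΩ
          exact lt_of_mul_lt_mul_left' (lt_of_lt_of_le hx hle)
    _ ≤ (C₁ + 2) * A * t ^ (-p) + C₂ * C₃ * D * κ ^ q * A * t ^ (-p) :=
        (measure_union_le _ _).trans (add_le_add hΩle hgood)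
    _ = _ := by ring

lemma hlMaximal_eq_maxMeas (f : 𝔼 → ℂ) (x : 𝔼) :
    hlMaximal f x = maxMeas (volume.withDensity fun z => ‖f z‖ₑ) x := by
  simp only [hlMaximal, maxMeas, withDensity_apply _ Metric.isOpen_ball.measurableSet]

lemma measure_le_of_weakLpNorm_le {p : ℝ} (hp : 0 < p) {F : 𝔼 → ℝ≥0∞} {N : ℝ≥0∞}
    (hF : weakLpNorm p F ≤ N) {s : ℝ≥0∞} (hs0 : s ≠ 0) (hs : s ≠ ∞) :
    volume {x | s < F x} ≤ N ^ p * s ^ (-p) := by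
  lift s to ℝ≥0 using hs
  have h1 : (s : ℝ≥0∞) * volume {x | (s : ℝ≥0∞) < F x} ^ (1 / p) ≤ N :=
    (le_iSup₂_of_le (f := fun (t : ℝ≥0) (_ : 0 < t) =>
      (t : ℝ≥0∞) * volume {x | (t : ℝ≥0∞) < F x} ^ (1 / p)) s
      (pos_iff_ne_zero.2 (by simpa using hs0)) le_rfl).trans hF
  have h2 := ENNReal.rpow_le_rpow h1 hp.le
  rw [ENNReal.mul_rpow_of_nonneg _ _ hp.le, ← ENNReal.rpow_mul, one_div_mul_cancel hp.ne',
    ENNReal.rpow_one] at h2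
  calc volume {x | (s : ℝ≥0∞) < F x}
      = (s : ℝ≥0∞) ^ p * volume {x | (s : ℝ≥0∞) < F x} * (s : ℝ≥0∞) ^ (-p) := by
        rw [mul_right_comm, ← ENNReal.rpow_add _ _ hs0 (by simp)]; simp
    _ ≤ _ := by gcongr

lemma weakLpNorm_le_of_measure_le {p : ℝ} (hp : 0 < p) {F : 𝔼 → ℝ≥0∞} {C N : ℝ≥0∞}
    (h : ∀ t : ℝ≥0∞, t ≠ 0 → t ≠ ∞ → volume {x | t < F x} ≤ C * N ^ p * t ^ (-p)) :
    weakLpNorm p F ≤ C ^ (1 / p) * N := by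
  refine iSup₂_le fun t ht => ?_
  have ht0 : (t : ℝ≥0∞) ≠ 0 := by simpa using ht.ne'
  rw [← ENNReal.rpow_le_rpow_iff hp, ENNReal.mul_rpow_of_nonneg _ _ hp.le,
    ENNReal.mul_rpow_of_nonneg _ _ hp.le, ← ENNReal.rpow_mul, ← ENNReal.rpow_mul,
    one_div_mul_cancel hp.ne', ENNReal.rpow_one, ENNReal.rpow_one]
  calc (t : ℝ≥0∞) ^ p * volume {x | (t : ℝ≥0∞) < F x}
      ≤ (t : ℝ≥0∞) ^ p * (C * N ^ p * (t : ℝ≥0∞) ^ (-p)) := by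
        gcongr; exact h t ht0 (by simp)
    _ = C * N ^ p * ((t : ℝ≥0∞) ^ p * (t : ℝ≥0∞) ^ (-p)) := by ring
    _ = C * N ^ p := by rw [← ENNReal.rpow_add _ _ ht0 (by simp)]; simp

end Maximal

theorem mainTheorem6 (n : ℕ) (p q : ℝ) (hp : 1 < p) (hq : 1 < q) :
    ∃ C : ℝ≥0, ∀ f : ℤ → EuclideanSpace ℝ (Fin n) → ℂ, MemWeakLpLq p q f →
      weakLpNorm p (fun x => lqNorm q (fun j => hlMaximal (f j) x)) ≤
        C * weakLpNorm p (fun x => lqNorm q (fun j => ‖f j x‖ₑ)) := by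
  have hp0 : 0 < p := by linarith
  obtain ⟨C, hC, h⟩ := exists_measure_lt_lqNorm_maxMeas_le_of_weak n hp hq
  lift C to ℝ≥0 using hC
  refine ⟨(C + 1) ^ (1 / p), fun f hf => ?_⟩
  have hC' : (((C + 1) ^ (1 / p) : ℝ≥0) : ℝ≥0∞) = ((C : ℝ≥0∞) + 1) ^ (1 / p) := by
    rw [ENNReal.coe_rpow_of_nonneg _ (by positivity)]; simp
  have hC0 : (((C + 1) ^ (1 / p) : ℝ≥0) : ℝ≥0∞) ≠ 0 := by
    rw [ENNReal.coe_ne_zero]; positivity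
  set u : ℤ → EuclideanSpace ℝ (Fin n) → ℝ≥0∞ := fun j => (hf.1 j).enorm.mk with hu
  have hum : ∀ j, Measurable (u j) := fun j => (hf.1 j).enorm.measurable_mk
  have hae : ∀ j, (fun x => ‖f j x‖ₑ) =ᵐ[volume] u j := fun j => (hf.1 j).enorm.ae_eq_mk
  have hG : (fun x => lqNorm q (fun j => ‖f j x‖ₑ)) =ᵐ[volume]
      fun x => lqNorm q (fun j => u j x) := by
    filter_upwards [ae_all_iff.2 hae] with x hx
    simp only [hx]
  simp_rw [hlMaximal_eq_maxMeas, withDensity_congr_ae (hae _)]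
  rw [mul_comm, ← ENNReal.div_le_iff hC0 (by simp)]
  -- the weak type inequality is applied with a bound `N` above the quasinorm, which may be zero
  refine le_of_forall_gt_imp_ge_of_dense fun N hN => ?_
  rw [ENNReal.div_le_iff hC0 (by simp), mul_comm, hC']
  rcases eq_or_ne N ∞ with rfl | hNt
  · rw [ENNReal.mul_top (by rwa [← hC'])]; exact le_top
  refine weakLpNorm_le_of_measure_le hp0 fun t ht0 ht => ?_
  refine (h u hum (N ^ p) (ENNReal.rpow_pos (bot_le.trans_lt hN) hNt).ne'
    (fun s hs0 hs => ?_) t ht0 ht).trans (by gcongr; exact le_self_add)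
  refine le_trans (le_of_eq (measure_congr ?_)) (measure_le_of_weakLpNorm_le hp0 hN.le hs0 hs)
  refine Filter.eventuallyEq_set.2 (hG.mono fun x hx => ?_)
  have hx' : lqNorm q (fun j => ‖f j x‖ₑ) = lqNorm q (fun j => u j x) := hx
  simp only [Set.mem_ofPred_eq, hx']
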